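/- Let $n\ge 1$, let $A,B,X$ be $n\times n$ complex matrices with $A$ and $B$ positive semidefinite, and let $|||\cdot|||$ be a unitarily invariant norm on the $n\times n$ complex matrices, i.e. a norm with $|||UYV|||=|||Y|||$ for all matrices $Y$ and all unitary matrices $U,V$. For $\tau\in(0,1)$ put $r(\tau)=\min\{\tau,1-\tau\}$ and $R(\tau)=1-r(\tau)$. Real powers of positive semidefinite matrices are defined by the functional calculus, with $A^0=B^0=I$. (i) If $0<\nu,\tau<1$ and either $\nu\le r(\tau)$ or $\nu\ge R(\tau)$, then $$|||A^{\nu}XB^{1-\nu}+A^{1-\nu}XB^{\nu}|||+\frac{\nu(1-\nu)}{\tau(1-\tau)}\Big[\big(|||AX|||+|||XB|||\big)-\big(|||AX|||^{\tau}\,|||XB|||^{1-\tau}+|||AX|||^{1-\tau}\,|||XB|||^{\tau}\big)\Big]\le |||AX|||+|||XB|||.$$ (ii) In particular (the case $\tau=\tfrac12$), for all $\nu\in[0,1]$, $$|||A^{\nu}XB^{1-\nu}+A^{1-\nu}XB^{\nu}|||+4\nu(1-\nu)\Big(\sqrt{|||AX|||}-\sqrt{|||XB|||}\Big)^2\le |||AX|||+|||XB|||.$$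 -/

import Mathlib

-- `ComplexOrder` and `MatrixOrder` provide the order on `ℂ` and the Loewner order on matrices, which
-- Mathlib's positive semidefiniteness and its real powers `A ^ (t : ℝ)` (through the continuous
-- functional calculus) are based on.
open scoped ComplexOrder MatrixOrder

/-- A unitarily invariant norm on the `n × n` complex matrices: a seminorm that is definite
(hence a norm) and satisfies `N (U * X * V) = N X` for all unitary matrices `U`, `V`. -/
structure IsUnitarilyInvariantNorm {n : ℕ} (N : Seminorm ℂ (Matrix (Fin n) (Fin n) ℂ)) : Prop where
  eq_zero_of_apply_eq_zero : ∀ X : Matrix (Fin n) (Fin n) ℂ, N X = 0 → X = 0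
  apply_unitary_mul_mul_unitary : ∀ X U V : Matrix (Fin n) (Fin n) ℂ,
    U ∈ Matrix.unitaryGroup (Fin n) ℂ → V ∈ Matrix.unitaryGroup (Fin n) ℂ →
      N (U * X * V) = N X

/-! With `a = N (A * X)` and `b = N (X * B)`, the triangle inequality and the interpolation bound `N
(A ^ ν * X * B ^ (1 - ν)) ≤ a ^ ν * b ^ (1 - ν)` leave a scalar inequality. The bound is the three
lines theorem for `A ^ z * X * B ^ (1 - z)`: on the lines `Re z = 0, 1` this is `X * B` or `A * X`
between imaginary powers, which do not increase `N`. In the scalar inequality, Heinz sums are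
hyperbolic cosines, `cosh s - cosh (t * s)` is compared with `1 - t ^ 2` through the power series,
and `ν`, `τ` enter only via `ν * (1 - ν) ≤ τ * (1 - τ)`. -/

open Complex Complex.HadamardThreeLines in
/-- **Hadamard's three lines theorem** for vector-valued exponential sums with real frequencies. -/
theorem norm_sum_exp_smul_le {E ι : Type*} [NormedAddCommGroup E] [NormedSpace ℂ E] [Fintype ι]
    (k : ι → ℝ) (e : ι → E) {M₀ M₁ : ℝ}
    (h₀ : ∀ y : ℝ, ‖∑ i, exp (y * I * k i) • e i‖ ≤ M₀)
    (h₁ : ∀ y : ℝ, ‖∑ i, exp ((1 + y * I) * k i) • e i‖ ≤ M₁)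
    {ν : ℝ} (hν₀ : 0 ≤ ν) (hν₁ : ν ≤ 1) :
    ‖∑ i, exp (ν * k i) • e i‖ ≤ M₀ ^ (1 - ν) * M₁ ^ ν := by
  have hd : Differentiable ℂ fun z : ℂ ↦ ∑ i, exp (z * k i) • e i := by fun_prop
  have key := norm_le_interp_of_mem_verticalClosedStrip₀₁' (fun z : ℂ ↦ ∑ i, exp (z * k i) • e i)
    (z := ν) (a := M₀) (b := M₁) ?_ hd.diffContOnCl ?_ ?_ ?_
  · simpa using key
  · simpa [verticalClosedStrip] using ⟨hν₀, hν₁⟩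
  · refine ⟨∑ i, Real.exp |k i| * ‖e i‖, ?_⟩
    rintro _ ⟨z, hz, rfl⟩
    simp only [verticalClosedStrip, Set.mem_preimage, Set.mem_Icc] at hz
    refine (norm_sum_le _ _).trans (Finset.sum_le_sum fun i _ ↦ ?_)
    rw [norm_smul, norm_exp]
    gcongr
    rw [re_mul_ofReal]
    calc z.re * k i ≤ |z.re * k i| := le_abs_self _
      _ = z.re * |k i| := by rw [abs_mul, abs_of_nonneg hz.1]
      _ ≤ |k i| := mul_le_of_le_one_left (abs_nonneg _) hz.2
  · intro z hz
    have hz' : z = z.im * I := by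
      apply Complex.ext <;> simp_all
    simpa [← hz'] using h₀ z.im
  · intro z hz
    have hz' : z = 1 + z.im * I := by
      apply Complex.ext <;> simp_all
    simpa [← hz'] using h₁ z.im

open Complex in
/-- The three lines theorem for exponential sums, for a definite seminorm on a vector space that
carries no norm. -/
theorem Seminorm.sum_exp_smul_le {V ι : Type*} [AddCommGroup V] [Module ℂ V] [Fintype ι]
    (N : Seminorm ℂ V) (hN : ∀ x, N x = 0 → x = 0) (k : ι → ℝ) (e : ι → V) {M₀ M₁ : ℝ}
    (h₀ : ∀ y : ℝ, N (∑ i, exp (y * I * k i) • e i) ≤ M₀)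
    (h₁ : ∀ y : ℝ, N (∑ i, exp ((1 + y * I) * k i) • e i) ≤ M₁)
    {ν : ℝ} (hν₀ : 0 ≤ ν) (hν₁ : ν ≤ 1) :
    N (∑ i, exp (ν * k i) • e i) ≤ M₀ ^ (1 - ν) * M₁ ^ ν := by
  let _ : Norm V := ⟨N⟩
  have core : NormedSpace.Core ℂ V :=
    { norm_nonneg := apply_nonneg N
      norm_smul := map_smul_eq_mul N
      norm_triangle := map_add_le_add N
      norm_eq_zero_iff := fun x ↦ ⟨hN x, fun h ↦ by rw [h]; exact map_zero N⟩ }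
  let _ : NormedAddCommGroup V := NormedAddCommGroup.ofCore core
  let _ : NormedSpace ℂ V := NormedSpace.ofCore core
  exact norm_sum_exp_smul_le k e h₀ h₁ hν₀ hν₁

namespace IsUnitarilyInvariantNorm

variable {n : ℕ} {N : Seminorm ℂ (Matrix (Fin n) (Fin n) ℂ)}

theorem apply_unitary_mul (hN : IsUnitarilyInvariantNorm N) (Y : Matrix (Fin n) (Fin n) ℂ)
    {U : Matrix (Fin n) (Fin n) ℂ} (hU : U ∈ Matrix.unitaryGroup (Fin n) ℂ) :
    N (U * Y) = N Y := by
  simpa using hN.apply_unitary_mul_mul_unitary Y U 1 hU (one_mem _)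

theorem apply_mul_unitary (hN : IsUnitarilyInvariantNorm N) (Y : Matrix (Fin n) (Fin n) ℂ)
    {V : Matrix (Fin n) (Fin n) ℂ} (hV : V ∈ Matrix.unitaryGroup (Fin n) ℂ) :
    N (Y * V) = N Y := by
  simpa using hN.apply_unitary_mul_mul_unitary Y 1 V (one_mem _) hV

/-- A diagonal matrix whose entries have modulus one or zero is a mean of two unitary matrices. -/
theorem _root_.Matrix.exists_unitary_add_eq_diagonal {d : Fin n → ℂ}
    (hd : ∀ i, ‖d i‖ = 1 ∨ d i = 0) :
    ∃ U ∈ Matrix.unitaryGroup (Fin n) ℂ, ∃ V ∈ Matrix.unitaryGroup (Fin n) ℂ,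
      Matrix.diagonal d = (2⁻¹ : ℂ) • (U + V) := by
  have hu : ∀ u : Fin n → ℂ, (∀ i, ‖u i‖ = 1) →
      Matrix.diagonal u ∈ Matrix.unitaryGroup (Fin n) ℂ := fun u hu ↦ by
    rw [Matrix.mem_unitaryGroup_iff, Matrix.star_eq_conjTranspose, Matrix.diagonal_conjTranspose,
      Matrix.diagonal_mul_diagonal, ← Matrix.diagonal_one]
    congr 1
    ext i
    simp [Complex.mul_conj', hu i]
  -- A zero entry is the mean of `1` and `-1`; a unimodular entry is kept in both.
  refine ⟨_, hu (fun i ↦ if d i = 0 then 1 else d i) fun i ↦ ?_,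
    _, hu (fun i ↦ if d i = 0 then -1 else d i) fun i ↦ ?_, ?_⟩
  · rcases hd i with h | h
    · have : d i ≠ 0 := fun h0 ↦ by simp [h0] at h
      simp [h, this]
    · simp [h]
  · rcases hd i with h | h
    · have : d i ≠ 0 := fun h0 ↦ by simp [h0] at h
      simp [h, this]
    · simp [h]
  · rw [Matrix.diagonal_add, ← Matrix.diagonal_smul]
    congr 1
    ext i
    by_cases h : d i = 0
    · simp [h]
    · simp [h]; ring

theorem apply_diagonal_mul_le (hN : IsUnitarilyInvariantNorm N) (Y : Matrix (Fin n) (Fin n) ℂ)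
    {d : Fin n → ℂ} (hd : ∀ i, ‖d i‖ = 1 ∨ d i = 0) : N (Matrix.diagonal d * Y) ≤ N Y := by
  obtain ⟨U, hU, V, hV, h⟩ := Matrix.exists_unitary_add_eq_diagonal hd
  rw [h, Matrix.smul_mul, map_smul_eq_mul, Matrix.add_mul]
  have := map_add_le_add N (U * Y) (V * Y)
  rw [hN.apply_unitary_mul Y hU, hN.apply_unitary_mul Y hV] at this
  norm_num
  linarith

theorem apply_mul_diagonal_le (hN : IsUnitarilyInvariantNorm N) (Y : Matrix (Fin n) (Fin n) ℂ)
    {d : Fin n → ℂ} (hd : ∀ i, ‖d i‖ = 1 ∨ d i = 0) : N (Y * Matrix.diagonal d) ≤ N Y := by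
  obtain ⟨U, hU, V, hV, h⟩ := Matrix.exists_unitary_add_eq_diagonal hd
  rw [h, Matrix.mul_smul, map_smul_eq_mul, Matrix.mul_add]
  have := map_add_le_add N (Y * U) (Y * V)
  rw [hN.apply_mul_unitary Y hU, hN.apply_mul_unitary Y hV] at this
  norm_num
  linarith

end IsUnitarilyInvariantNorm

open Complex in
/-- The power `a ^ z` of a nonnegative real, with the convention `0 ^ z = 0` for every `z`. -/
noncomputable def suppPow (a : ℝ) (z : ℂ) : ℂ := if a = 0 then 0 else exp (z * Real.log a)

theorem suppPow_add (a : ℝ) (z w : ℂ) : suppPow a (z + w) = suppPow a z * suppPow a w := by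
  unfold suppPow
  split_ifs
  · simp
  · rw [add_mul, Complex.exp_add]

theorem suppPow_ofReal {a : ℝ} (ha : 0 ≤ a) {t : ℝ} (ht : t ≠ 0) :
    suppPow a t = ((a ^ t : ℝ) : ℂ) := by
  unfold suppPow
  split_ifs with h
  · simp [h, Real.zero_rpow ht]
  · rw [Real.rpow_def_of_pos (lt_of_le_of_ne ha (Ne.symm h))]
    push_cast
    rw [mul_comm]

theorem suppPow_one {a : ℝ} (ha : 0 ≤ a) : suppPow a 1 = a := by
  simpa using suppPow_ofReal ha one_ne_zero

theorem norm_suppPow_mul_I (a y : ℝ) :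
    ‖suppPow a (y * Complex.I)‖ = 1 ∨ suppPow a (y * Complex.I) = 0 := by
  unfold suppPow
  split_ifs
  · simp
  · left
    simp [Complex.norm_exp]

namespace IsUnitarilyInvariantNorm

variable {n : ℕ} {N : Seminorm ℂ (Matrix (Fin n) (Fin n) ℂ)}

open Matrix in
theorem apply_diagonal_rpow_mul_mul_diagonal_rpow_le (hN : IsUnitarilyInvariantNorm N)
    (Y : Matrix (Fin n) (Fin n) ℂ) {a b : Fin n → ℝ} (ha : ∀ i, 0 ≤ a i) (hb : ∀ i, 0 ≤ b i)
    {ν : ℝ} (hν₀ : 0 < ν) (hν₁ : ν < 1) :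
    N (diagonal (fun i ↦ ((a i ^ ν : ℝ) : ℂ)) * Y * diagonal fun i ↦ ((b i ^ (1 - ν) : ℝ) : ℂ)) ≤
      N (diagonal (fun i ↦ (a i : ℂ)) * Y) ^ ν * N (Y * diagonal fun i ↦ (b i : ℂ)) ^ (1 - ν) := by
  -- Entrywise, `a ^ z * y * b ^ (1 - z) = exp (z * (log a - log b)) * (y * b)`. Where `a` or `b`
  -- vanishes the coefficient is zero, so the value `Real.log 0 = 0` is harmless.
  have hF : ∀ z : ℂ, ∑ p : Fin n × Fin n,
      Complex.exp (z * (Real.log (a p.1) - Real.log (b p.2) : ℝ)) •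
        (if a p.1 = 0 then 0 else single p.1 p.2 (Y p.1 p.2 * suppPow (b p.2) 1)) =
      diagonal (fun i ↦ suppPow (a i) z) * Y * diagonal (fun i ↦ suppPow (b i) (1 - z)) := by
    intro z
    rw [matrix_eq_sum_single (diagonal (fun i ↦ suppPow (a i) z) * Y *
      diagonal (fun i ↦ suppPow (b i) (1 - z))), Fintype.sum_prod_type]
    refine Finset.sum_congr rfl fun i _ ↦ Finset.sum_congr rfl fun j _ ↦ ?_
    rw [mul_diagonal, diagonal_mul]
    unfold suppPow
    split_ifs with h₁ h₂
    · simp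
    · simp
    · simp
    · rw [smul_single, smul_eq_mul]
      congr 1
      have h : Complex.exp (z * (Real.log (a i) - Real.log (b j) : ℝ)) *
          Complex.exp (1 * Real.log (b j)) =
            Complex.exp (z * Real.log (a i)) * Complex.exp ((1 - z) * Real.log (b j)) := by
        rw [← Complex.exp_add, ← Complex.exp_add]
        congr 1
        push_cast
        ring
      linear_combination Y i j * h
  have hreg : ∀ y : ℝ, ∀ b : ℝ, ‖suppPow b (-(y * Complex.I))‖ = 1 ∨
      suppPow b (-(y * Complex.I)) = 0 := fun y b ↦ by
    simpa using norm_suppPow_mul_I b (-y)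
  have key := N.sum_exp_smul_le hN.eq_zero_of_apply_eq_zero
    (fun p : Fin n × Fin n ↦ Real.log (a p.1) - Real.log (b p.2))
    (fun p ↦ if a p.1 = 0 then 0 else single p.1 p.2 (Y p.1 p.2 * suppPow (b p.2) 1))
    (M₀ := N (Y * diagonal fun i ↦ (b i : ℂ))) (M₁ := N (diagonal (fun i ↦ (a i : ℂ)) * Y))
    ?_ ?_ hν₀.le hν₁.le
  · rw [hF] at key
    have hr : (1 : ℂ) - ν = ((1 - ν : ℝ) : ℂ) := by push_cast; rfl
    simp only [hr] at key
    simp only [suppPow_ofReal (ha _) hν₀.ne', suppPow_ofReal (hb _) (sub_pos.2 hν₁).ne'] at key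
    rwa [mul_comm (_ ^ ν)]
  · intro y
    rw [hF]
    have : diagonal (fun i ↦ suppPow (b i) (1 - y * Complex.I)) =
        diagonal (fun i ↦ (b i : ℂ)) * diagonal (fun i ↦ suppPow (b i) (-(y * Complex.I))) := by
      rw [diagonal_mul_diagonal]
      simp only [sub_eq_add_neg, suppPow_add, suppPow_one (hb _)]
    rw [this, ← mul_assoc, mul_assoc (diagonal _) Y]
    exact (hN.apply_mul_diagonal_le _ fun i ↦ hreg y (b i)).trans
      (hN.apply_diagonal_mul_le _ fun i ↦ norm_suppPow_mul_I (a i) y)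
  · intro y
    rw [hF]
    have : diagonal (fun i ↦ suppPow (a i) (1 + y * Complex.I)) =
        diagonal (fun i ↦ suppPow (a i) (y * Complex.I)) * diagonal (fun i ↦ (a i : ℂ)) := by
      rw [diagonal_mul_diagonal]
      simp only [add_comm (1 : ℂ), suppPow_add, suppPow_one (ha _)]
    rw [this, mul_assoc (diagonal _) (diagonal _) Y, sub_add_cancel_left]
    exact (hN.apply_mul_diagonal_le _ fun i ↦ hreg y (b i)).trans
      (hN.apply_diagonal_mul_le _ fun i ↦ norm_suppPow_mul_I (a i) y)

/-- The spectral form of all real powers of a positive semidefinite matrix. -/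
theorem _root_.Matrix.PosSemidef.exists_unitary_rpow_eq {A : Matrix (Fin n) (Fin n) ℂ}
    (hA : A.PosSemidef) :
    ∃ U ∈ Matrix.unitaryGroup (Fin n) ℂ, ∃ a : Fin n → ℝ, (∀ i, 0 ≤ a i) ∧
      ∀ t : ℝ, A ^ t = U * Matrix.diagonal (fun i ↦ ((a i ^ t : ℝ) : ℂ)) * star U := by
  refine ⟨hA.isHermitian.eigenvectorUnitary, SetLike.coe_mem _, hA.isHermitian.eigenvalues,
    hA.eigenvalues_nonneg, fun t ↦ ?_⟩
  rw [CFC.rpow_eq_cfc_real (Matrix.nonneg_iff_posSemidef.2 hA), hA.isHermitian.cfc_eq,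
    Matrix.IsHermitian.cfc, Unitary.conjStarAlgAut_apply]
  rfl

open Matrix in
/-- `|||A ^ ν X B ^ (1 - ν)||| ≤ |||A X||| ^ ν |||X B||| ^ (1 - ν)` for positive semidefinite `A`
and `B`. -/
theorem apply_rpow_mul_mul_rpow_le (hN : IsUnitarilyInvariantNorm N)
    {A B : Matrix (Fin n) (Fin n) ℂ} (X : Matrix (Fin n) (Fin n) ℂ)
    (hA : A.PosSemidef) (hB : B.PosSemidef) {ν : ℝ} (hν₀ : 0 < ν) (hν₁ : ν < 1) :
    N (A ^ ν * X * B ^ (1 - ν)) ≤ N (A * X) ^ ν * N (X * B) ^ (1 - ν) := by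
  obtain ⟨U, hU, a, ha, hAt⟩ := hA.exists_unitary_rpow_eq
  obtain ⟨V, hV, b, hb, hBt⟩ := hB.exists_unitary_rpow_eq
  have hU' : star U ∈ unitaryGroup (Fin n) ℂ := Unitary.star_mem hU
  have hV' : star V ∈ unitaryGroup (Fin n) ℂ := Unitary.star_mem hV
  have hA₁ := hAt 1
  have hB₁ := hBt 1
  rw [CFC.rpow_one A (nonneg_iff_posSemidef.2 hA)] at hA₁
  rw [CFC.rpow_one B (nonneg_iff_posSemidef.2 hB)] at hB₁
  simp only [Real.rpow_one] at hA₁ hB₁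
  have key := hN.apply_diagonal_rpow_mul_mul_diagonal_rpow_le (star U * X * V) ha hb hν₀ hν₁
  have h₁ : N (A * X) = N (diagonal (fun i ↦ (a i : ℂ)) * (star U * X * V)) := by
    rw [← hN.apply_unitary_mul_mul_unitary (diagonal (fun i ↦ (a i : ℂ)) * (star U * X * V))
      U (star V) hU hV', hA₁]
    simp only [mul_assoc, mem_unitaryGroup_iff.1 hV, mul_one]
  have h₂ : N (X * B) = N ((star U * X * V) * diagonal (fun i ↦ (b i : ℂ))) := by
    rw [← hN.apply_unitary_mul_mul_unitary ((star U * X * V) * diagonal (fun i ↦ (b i : ℂ)))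
      U (star V) hU hV', hB₁]
    simp only [← mul_assoc, mem_unitaryGroup_iff.1 hU, one_mul]
  rw [← hN.apply_unitary_mul_mul_unitary _ U (star V) hU hV'] at key
  rw [hAt, hBt, h₁, h₂]
  simpa only [mul_assoc] using key

end IsUnitarilyInvariantNorm

/-- The quotient `(1 - x ^ k) / (1 - x)` is a geometric sum, hence increasing in `x ≥ 0`. -/
theorem one_sub_mul_one_sub_pow_le {x y : ℝ} (hx : 0 ≤ x) (hxy : x ≤ y) (hy : y ≤ 1) (k : ℕ) :
    (1 - y) * (1 - x ^ k) ≤ (1 - x) * (1 - y ^ k) := by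
  rw [← mul_neg_geom_sum x, ← mul_neg_geom_sum y, mul_left_comm]
  have : 0 ≤ 1 - y := by linarith
  have : 0 ≤ 1 - x := by linarith
  gcongr

/-- `(cosh s - cosh (t s)) / (1 - t ^ 2)` increases with `|t|` on `[-1, 1]`. -/
theorem one_sub_sq_mul_cosh_sub_cosh_le (s : ℝ) {t u : ℝ} (htu : t ^ 2 ≤ u ^ 2) (hu : u ^ 2 ≤ 1) :
    (1 - u ^ 2) * (Real.cosh s - Real.cosh (t * s)) ≤
      (1 - t ^ 2) * (Real.cosh s - Real.cosh (u * s)) := by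
  -- The coefficients are nonnegative, so the series can be compared term by term.
  have h : ∀ v : ℝ, HasSum (fun k ↦ s ^ (2 * k) / (2 * k).factorial * (1 - (v ^ 2) ^ k))
      (Real.cosh s - Real.cosh (v * s)) := fun v ↦ by
    refine ((Real.hasSum_cosh s).sub (Real.hasSum_cosh (v * s))).congr_fun fun k ↦ ?_
    rw [mul_pow, ← pow_mul v]
    ring
  refine hasSum_le (fun k ↦ ?_) ((h t).mul_left _) ((h u).mul_left _)
  rw [mul_left_comm, mul_left_comm (1 - t ^ 2)]
  have : 0 ≤ s ^ (2 * k) := by rw [pow_mul]; positivity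
  exact mul_le_mul_of_nonneg_left (one_sub_mul_one_sub_pow_le (sq_nonneg t) htu hu k)
    (by positivity)

/-- A refinement of the scalar inequality between the arithmetic and the Heinz mean. -/
theorem mul_add_sub_heinz_le {a b ν τ : ℝ} (ha : 0 < a) (hb : 0 < b) (hν : 0 ≤ ν * (1 - ν))
    (h : ν * (1 - ν) ≤ τ * (1 - τ)) :
    ν * (1 - ν) * (a + b - (a ^ τ * b ^ (1 - τ) + a ^ (1 - τ) * b ^ τ)) ≤
      τ * (1 - τ) * (a + b - (a ^ ν * b ^ (1 - ν) + a ^ (1 - ν) * b ^ ν)) := by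
  obtain ⟨p, rfl⟩ : ∃ p, a = Real.exp p := ⟨Real.log a, (Real.exp_log ha).symm⟩
  obtain ⟨q, rfl⟩ : ∃ q, b = Real.exp q := ⟨Real.log b, (Real.exp_log hb).symm⟩
  have hg : ∀ t : ℝ, Real.exp p ^ t * Real.exp q ^ (1 - t) + Real.exp p ^ (1 - t) * Real.exp q ^ t
      = 2 * Real.exp ((p + q) / 2) * Real.cosh ((1 - 2 * t) * ((p - q) / 2)) := fun t ↦ by
    rw [Real.cosh_eq, mul_assoc, mul_left_comm, mul_div_cancel₀ _ two_ne_zero, mul_add]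
    simp only [← Real.exp_mul, ← Real.exp_add]
    rw [add_comm]
    congr 2 <;> ring
  have hs := hg 0
  simp only [Real.rpow_zero, Real.rpow_one, sub_zero, one_mul, mul_one, mul_zero] at hs
  -- Since `1 - (1 - 2 * t) ^ 2 = 4 * t * (1 - t)`, the hypotheses become those on squares.
  have key := one_sub_sq_mul_cosh_sub_cosh_le ((p - q) / 2) (t := 1 - 2 * τ) (u := 1 - 2 * ν)
    (by nlinarith) (by nlinarith)
  rw [hg, hg, add_comm (Real.exp p), hs]
  have hm := mul_le_mul_of_nonneg_left key (Real.exp_pos ((p + q) / 2)).le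
  linear_combination hm / 2

theorem heinz_add_le {a b ν τ : ℝ} (ha : 0 ≤ a) (hb : 0 ≤ b) (hν₀ : 0 < ν) (hν₁ : ν < 1)
    (hτ₀ : 0 < τ) (hτ₁ : τ < 1) (h : ν * (1 - ν) ≤ τ * (1 - τ)) :
    a ^ ν * b ^ (1 - ν) + a ^ (1 - ν) * b ^ ν + ν * (1 - ν) / (τ * (1 - τ)) *
      (a + b - (a ^ τ * b ^ (1 - τ) + a ^ (1 - τ) * b ^ τ)) ≤ a + b := by
  have hν : 0 < ν * (1 - ν) := mul_pos hν₀ (by linarith)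
  have hτ : 0 < τ * (1 - τ) := hν.trans_le h
  have h1ν : 1 - ν ≠ 0 := by linarith
  have h1τ : 1 - τ ≠ 0 := by linarith
  have main : ν * (1 - ν) * (a + b - (a ^ τ * b ^ (1 - τ) + a ^ (1 - τ) * b ^ τ)) ≤
      τ * (1 - τ) * (a + b - (a ^ ν * b ^ (1 - ν) + a ^ (1 - ν) * b ^ ν)) := by
    rcases ha.eq_or_lt with rfl | ha'
    · simpa [Real.zero_rpow, hν₀.ne', hτ₀.ne', h1ν, h1τ] using mul_le_mul_of_nonneg_right h hb
    rcases hb.eq_or_lt with rfl | hb'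
    · simpa [Real.zero_rpow, hν₀.ne', hτ₀.ne', h1ν, h1τ] using mul_le_mul_of_nonneg_right h ha
    exact mul_add_sub_heinz_le ha' hb' hν.le h
  rw [div_mul_eq_mul_div, ← le_sub_iff_add_le', div_le_iff₀ hτ, mul_comm _ (τ * (1 - τ))]
  exact main

theorem IsUnitarilyInvariantNorm.apply_heinz_add_le {n : ℕ}
    {N : Seminorm ℂ (Matrix (Fin n) (Fin n) ℂ)} (hN : IsUnitarilyInvariantNorm N)
    {A B : Matrix (Fin n) (Fin n) ℂ} (X : Matrix (Fin n) (Fin n) ℂ)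
    (hA : A.PosSemidef) (hB : B.PosSemidef) {ν τ : ℝ} (hν₀ : 0 < ν) (hν₁ : ν < 1)
    (hτ₀ : 0 < τ) (hτ₁ : τ < 1) (h : ν * (1 - ν) ≤ τ * (1 - τ)) :
    N (A ^ ν * X * B ^ (1 - ν) + A ^ (1 - ν) * X * B ^ ν)
      + ν * (1 - ν) / (τ * (1 - τ)) * ((N (A * X) + N (X * B))
        - (N (A * X) ^ τ * N (X * B) ^ (1 - τ) + N (A * X) ^ (1 - τ) * N (X * B) ^ τ))
      ≤ N (A * X) + N (X * B) := by
  have h₁ := hN.apply_rpow_mul_mul_rpow_le X hA hB hν₀ hν₁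
  have h₂ := hN.apply_rpow_mul_mul_rpow_le X hA hB (sub_pos.2 hν₁) (sub_lt_self 1 hν₀)
  rw [sub_sub_cancel] at h₂
  refine le_trans ?_ (heinz_add_le (apply_nonneg N (A * X)) (apply_nonneg N (X * B))
    hν₀ hν₁ hτ₀ hτ₁ h)
  gcongr
  exact (map_add_le_add N _ _).trans (add_le_add h₁ h₂)

theorem mainTheorem8 {n : ℕ} (A B X : Matrix (Fin n) (Fin n) ℂ)
    (hA : A.PosSemidef) (hB : B.PosSemidef)
    (N : Seminorm ℂ (Matrix (Fin n) (Fin n) ℂ)) (hN : IsUnitarilyInvariantNorm N) :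
    (∀ ν τ : ℝ, 0 < ν → ν < 1 → 0 < τ → τ < 1 →
      (ν ≤ min τ (1 - τ) ∨ 1 - min τ (1 - τ) ≤ ν) →
        N (A ^ ν * X * B ^ (1 - ν) + A ^ (1 - ν) * X * B ^ ν)
          + ν * (1 - ν) / (τ * (1 - τ))
            * ((N (A * X) + N (X * B))
              - (N (A * X) ^ τ * N (X * B) ^ (1 - τ) + N (A * X) ^ (1 - τ) * N (X * B) ^ τ))
          ≤ N (A * X) + N (X * B)) ∧
    (∀ ν : ℝ, 0 ≤ ν → ν ≤ 1 →
        N (A ^ ν * X * B ^ (1 - ν) + A ^ (1 - ν) * X * B ^ ν)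
          + 4 * ν * (1 - ν) * (√(N (A * X)) - √(N (X * B))) ^ 2
          ≤ N (A * X) + N (X * B)) := by
  refine ⟨fun ν τ hν₀ hν₁ hτ₀ hτ₁ h ↦ hN.apply_heinz_add_le X hA hB hν₀ hν₁ hτ₀ hτ₁ ?_,
    fun ν hν₀ hν₁ ↦ ?_⟩
  -- Either alternative puts `ν` at least as far from `1 / 2` as `τ`.
  · rcases min_cases τ (1 - τ) with ⟨hm, _⟩ | ⟨hm, _⟩ <;> rw [hm] at h <;> rcases h with h | h <;>
      nlinarith
  have hA0 : 0 ≤ A := Matrix.nonneg_iff_posSemidef.2 hA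
  have hB0 : 0 ≤ B := Matrix.nonneg_iff_posSemidef.2 hB
  -- At the endpoints the correction vanishes and the triangle inequality suffices.
  rcases hν₀.eq_or_lt with rfl | hν₀
  · simpa [CFC.rpow_zero A hA0, CFC.rpow_zero B hB0, CFC.rpow_one A hA0, CFC.rpow_one B hB0,
      add_comm] using map_add_le_add N (A * X) (X * B)
  rcases hν₁.eq_or_lt with rfl | hν₁
  · simpa [CFC.rpow_zero A hA0, CFC.rpow_zero B hB0, CFC.rpow_one A hA0, CFC.rpow_one B hB0]
      using map_add_le_add N (A * X) (X * B)
  have key := hN.apply_heinz_add_le X hA hB hν₀ hν₁ (τ := 1 / 2) (by norm_num) (by norm_num)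
    (by nlinarith [sq_nonneg (1 - 2 * ν)])
  have ha := Real.sq_sqrt (apply_nonneg N (A * X))
  have hb := Real.sq_sqrt (apply_nonneg N (X * B))
  rw [show (1 : ℝ) - 1 / 2 = 1 / 2 by norm_num, ← Real.sqrt_eq_rpow, ← Real.sqrt_eq_rpow] at key
  refine le_trans (le_of_eq ?_) key
  linear_combination (4 * ν * (1 - ν)) * (ha + hb)
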